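/- **Proposition (Monotonicity under partial trace).** All Hilbert spaces are finite-dimensional and complex. Let $f:(0,\infty)\to\mathbb{R}$ be operator anti-monotone, i.e. for all Hermitian operators $A,B$ of the same finite dimension with spectra in $(0,\infty)$, $A\le B$ implies $f(B)\le f(A)$. For a Hilbert space $\mathcal{H}_S$ with a fixed orthonormal basis $\{|i\rangle\}_i$, an isomorphic copy $\mathcal{H}_{\hat S}$ with the corresponding basis, and a positive semidefinite operator $X$ on $\mathcal{H}_S$, put $$|\Gamma\rangle_{S\hat S}=\sum_i |i\rangle_S|i\rangle_{\hat S},\qquad |\varphi^X\rangle_{S\hat S}=(X_S^{1/2}\otimes I_{\hat S})|\Gamma\rangle_{S\hat S}.$$ For positive definite operators $Z,\tau$ on $\mathcal{H}_S$ let $$\widetilde{Q}_f(X\Vert Z;\tau)=\langle\varphi^X|\,f(\tau_S^{-1}\otimes Z_{\hat S}^{T})\,|\varphi^X\rangle ,$$ where $T$ is the transpose with respect to the fixed basis. For positive semidefinite $Y$ on $\mathcal{H}_S$, with $\Pi_Y^{\perp}$ the orthogonal projection onto $\ker Y$, the optimized quantum $f$-divergence is $$\widetilde{Q}_f(X\Vert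 Y)=\sup_{\tau>0,\ \operatorname{Tr}\tau\le 1,\ \varepsilon>0}\widetilde{Q}_f(X\Vert Y+\varepsilon\Pi_Y^{\perp};\tau)\in(-\infty,+\infty].$$ Let $X_{AB}$ and $Y_{AB}$ be arbitrary positive semidefinite operators on $\mathcal{H}_A\otimes\mathcal{H}_B$ (neither is assumed invertible, nor are their partial traces), where the tensor product carries the product of the fixed bases of $\mathcal{H}_A$ and $\mathcal{H}_B$, and let $X_A=\operatorname{Tr}_B X_{AB}$ and $Y_A=\operatorname{Tr}_B Y_{AB}$. Then $$\widetilde{Q}_f(X_{AB}\Vert Y_{AB})\ \ge\ \widetilde{Q}_f(X_A\Vert Y_A).$$ -/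

import Mathlib

open scoped Matrix Kronecker ComplexOrder MatrixOrder

noncomputable section

/-- `f`, regarded as a real function on `(0, ∞)` (its values elsewhere play no role), is operator
anti-monotone: `A ≤ B` implies `f(B) ≤ f(A)` in the Loewner order, for all Hermitian complex
matrices `A`, `B` of equal (arbitrary finite) size whose spectra lie in `(0, ∞)`. -/
def OperatorAntiMonotone (f : ℝ → ℝ) : Prop :=
  ∀ (n : ℕ) (A B : Matrix (Fin n) (Fin n) ℂ), A.PosDef → B.PosDef → A ≤ B → cfc f B ≤ cfc f A

/-- The orthogonal projection onto the kernel of `Y`, as a matrix in the standard basis. -/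
def kernelProj {s : Type*} [Fintype s] [DecidableEq s] (Y : Matrix s s ℂ) : Matrix s s ℂ :=
  (Matrix.toEuclideanCLM (n := s) (𝕜 := ℂ)).symm
    (LinearMap.ker (Matrix.toEuclideanCLM (n := s) (𝕜 := ℂ) Y).toLinearMap).starProjection

/-- The unnormalized maximally entangled vector `|Γ⟩ = ∑ i, |i⟩ ⊗ |i⟩`. -/
def gammaVec (s : Type*) [DecidableEq s] : s × s → ℂ :=
  fun p => if p.1 = p.2 then 1 else 0

/-- The vector `|φ^X⟩ = (X^{1/2} ⊗ I) |Γ⟩`. -/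
def phiVec {s : Type*} [Fintype s] [DecidableEq s] (X : Matrix s s ℂ) : s × s → ℂ :=
  (CFC.sqrt X ⊗ₖ (1 : Matrix s s ℂ)) *ᵥ gammaVec s

/-- `⟨φ^X| f(τ⁻¹ ⊗ Zᵀ) |φ^X⟩`, used for positive definite `Z` and `τ`. The matrix `f(τ⁻¹ ⊗ Zᵀ)` is
Hermitian, so the complex number whose real part is taken is real
(see `qTau_im_eq_zero`). -/
def qTau {s : Type*} [Fintype s] [DecidableEq s] (f : ℝ → ℝ) (X Z τ : Matrix s s ℂ) : ℝ :=
  (star (phiVec X) ⬝ᵥ (cfc f (τ⁻¹ ⊗ₖ Zᵀ) *ᵥ phiVec X)).re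

theorem qTau_im_eq_zero {s : Type*} [Fintype s] [DecidableEq s] (f : ℝ → ℝ)
    (X Z τ : Matrix s s ℂ) :
    (star (phiVec X) ⬝ᵥ (cfc f (τ⁻¹ ⊗ₖ Zᵀ) *ᵥ phiVec X)).im = 0 := by
  have h : (cfc f (τ⁻¹ ⊗ₖ Zᵀ)).IsHermitian := cfc_predicate (R := ℝ) (p := IsSelfAdjoint) f _
  exact h.im_star_dotProduct_mulVec_self _

/-- The optimized quantum `f`-divergence of `X` and `Y`: the supremum of
`qTau f X (Y + ε Π_Y^⊥) τ` over `τ > 0` with `Tr τ ≤ 1` and over `ε > 0`, possibly `+∞`. -/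
def optimizedFDiv {s : Type*} [Fintype s] [DecidableEq s] (f : ℝ → ℝ) (X Y : Matrix s s ℂ) :
    EReal :=
  ⨆ (τ : Matrix s s ℂ) (_ : τ.PosDef) (_ : τ.trace ≤ 1) (ε : ℝ) (_ : 0 < ε),
    (qTau f X (Y + (ε : ℂ) • kernelProj Y) τ : EReal)

/-- The partial trace over the second tensor factor. -/
def partialTraceRight {a b : Type*} [Fintype b] (M : Matrix (a × b) (a × b) ℂ) : Matrix a a ℂ :=
  Matrix.of fun i j => ∑ k : b, M (i, k) (j, k)

end

/-! Every value `qTau` on the marginal is matched, up to an arbitrary `e > 0`, by a feasible value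
on the composite system. Put `ρ = Tr_B X`. There is an operator `S` with `Tr_B (Sᴴ S) = 1` and `S
(ρ^{1/2} ⊗ 1) = X^{1/2}` (`exists_partialTraceRight_eq_one`). Then `W = (S ⊗ 1) * gammaEmbedding` is
an isometry that carries `φ^ρ` to `φ^X`.

For `τ'` slightly above a rescaled `S (τ ⊗ 1) Sᴴ`, a Schur complement argument shows that `W`
compresses `τ'⁻¹ ⊗ Z'ᵀ` below a multiple, close to 1, of `τ⁻¹ ⊗ Zᵀ`, where `Z` and `Z'` are the
regularizations of `Tr_B Y` and `Y`. Jensen's operator inequality, obtained from pinching, turns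
this into a comparison of the values of `f`, again at the cost of a factor `1 + η`.

All these dilation factors are absorbed by right-continuity of `f`, which is not assumed: it follows
from Jensen on 2 × 2 matrices via an approximate midpoint convexity (`le_midpoint`,
`exists_sub_le`). -/

section LoewnerOrder

theorem Matrix.conjTranspose_mul_mul_mono {m n : Type*} [Fintype m] [Fintype n]
    {A B : Matrix m m ℂ} (h : A ≤ B)
    (W : Matrix m n ℂ) : Wᴴ * A * W ≤ Wᴴ * B * W := by
  rw [Matrix.le_iff] at h ⊢
  simpa [Matrix.mul_sub, Matrix.sub_mul] using h.conjTranspose_mul_mul_same W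

theorem Matrix.PosDef.of_le {m : Type*} {A B : Matrix m m ℂ} (hA : A.PosDef) (h : A ≤ B) :
    B.PosDef := by
  have := hA.add_posSemidef (Matrix.le_iff.1 h)
  simpa using this

theorem Matrix.smul_mono {m : Type*} {A B : Matrix m m ℂ} (h : A ≤ B) {r : ℝ} (hr : 0 ≤ r) :
    r • A ≤ r • B := by
  rw [Matrix.le_iff, ← smul_sub]
  exact (Matrix.le_iff.1 h).smul hr

end LoewnerOrder

/-! ### Intertwining, pinching and Jensen's inequality for matrices. -/

section FunctionalCalculus

variable {m n : Type*} [Fintype m] [DecidableEq m] [Fintype n] [DecidableEq n]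

/-- The spectrum is finite, so the functional calculus applies to arbitrary `g`; hence `f` needs no
regularity. -/
theorem Matrix.continuousOn_real_spectrum (g : ℝ → ℝ) (A : Matrix m m ℂ) :
    ContinuousOn g (spectrum ℝ A) :=
  A.finite_real_spectrum.continuousOn g

/-- A rectangular matrix intertwining two Hermitian matrices intertwines their images under the
functional calculus. -/
theorem Matrix.cfc_mul_eq_mul_cfc (f : ℝ → ℝ) {A : Matrix m m ℂ} {B : Matrix n n ℂ}
    {W : Matrix m n ℂ} (hA : A.IsHermitian) (hB : B.IsHermitian) (h : A * W = W * B) :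
    cfc f A * W = W * cfc f B := by
  -- Interpolating on the union of both spectra gives a single polynomial that represents `f` at `A`
  -- and at `B`.
  set s : Finset ℝ := A.finite_real_spectrum.toFinset ∪ B.finite_real_spectrum.toFinset with hs
  set p := Lagrange.interpolate s id f
  have hp : ∀ x ∈ s, f x = p.eval x := fun x hx =>
    (Lagrange.eval_interpolate_at_node (v := id) f Function.injective_id.injOn hx).symm
  have hA' : IsSelfAdjoint A := hA
  have hB' : IsSelfAdjoint B := hB
  have eA : cfc f A = Polynomial.aeval A p := by
    rw [← cfc_polynomial p A]
    exact cfc_congr fun x hx => hp x (by simp [hs, hx])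
  have eB : cfc f B = Polynomial.aeval B p := by
    rw [← cfc_polynomial p B]
    exact cfc_congr fun x hx => hp x (by simp [hs, hx])
  rw [eA, eB]
  have hpow : ∀ k : ℕ, A ^ k * W = W * B ^ k := by
    intro k
    induction k with
    | zero => simp
    | succ k ih => rw [pow_succ', Matrix.mul_assoc, ih, ← Matrix.mul_assoc, h, Matrix.mul_assoc,
        ← pow_succ']
  rw [Polynomial.aeval_eq_sum_range, Polynomial.aeval_eq_sum_range, Matrix.sum_mul,
    Matrix.mul_sum]
  exact Finset.sum_congr rfl fun k _ => by rw [Matrix.smul_mul, hpow, Matrix.mul_smul]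

/-- An operator anti-monotone function is anti-monotone on matrices over any finite index type. -/
theorem OperatorAntiMonotone.cfc_le_cfc {f : ℝ → ℝ} (hf : OperatorAntiMonotone f)
    {A B : Matrix m m ℂ} (hA : A.PosDef) (h : A ≤ B) : cfc f B ≤ cfc f A := by
  have hB := hA.of_le h
  let e := Fintype.equivFin m
  -- The unitary that relabels the index type.
  let U : Matrix m (Fin (Fintype.card m)) ℂ := (1 : Matrix m m ℂ).submatrix id e.symm
  have hU : U * Uᴴ = 1 := by
    simp [U, Matrix.conjTranspose_submatrix, Matrix.submatrix_mul_equiv]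
  have hU' : Uᴴ * U = 1 := by
    have := Matrix.submatrix_mul_equiv (1 : Matrix m m ℂ) (1 : Matrix m m ℂ) e.symm
      (Equiv.refl m) e.symm
    simp only [Equiv.coe_refl] at this
    simp [U, Matrix.conjTranspose_submatrix, this]
  have hUi : Function.Injective U.mulVec := fun x y hxy => by
    have := congrArg (Uᴴ *ᵥ ·) hxy
    simpa [Matrix.mulVec_mulVec, hU'] using this
  have key : ∀ C : Matrix m m ℂ, C.IsHermitian → U * cfc f (Uᴴ * C * U) * Uᴴ = cfc f C := by
    intro C hC
    have hC' : (Uᴴ * C * U).IsHermitian := Matrix.isHermitian_conjTranspose_mul_mul U hC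
    rw [← Matrix.cfc_mul_eq_mul_cfc f hC hC', Matrix.mul_assoc, hU, Matrix.mul_one]
    simp only [← Matrix.mul_assoc, hU, Matrix.one_mul]
  have := hf _ _ _ (hA.conjTranspose_mul_mul_same hUi) (hB.conjTranspose_mul_mul_same hUi)
    (Matrix.conjTranspose_mul_mul_mono h U)
  have := Matrix.conjTranspose_mul_mul_mono this Uᴴ
  simpa only [Matrix.conjTranspose_conjTranspose, key A hA.1, key B hB.1] using this

theorem Matrix.PosDef.exists_pos_smul_one_le {A : Matrix m m ℂ} (hA : A.PosDef) :
    ∃ r : ℝ, 0 < r ∧ r • (1 : Matrix m m ℂ) ≤ A := by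
  cases subsingleton_or_nontrivial (Matrix m m ℂ)
  · exact ⟨1, one_pos, (Subsingleton.elim _ _).le⟩
  · have hs : IsSelfAdjoint A := hA.1
    obtain ⟨r, hr, h⟩ := (CFC.exists_pos_algebraMap_le_iff hs).2
      fun x hx => hA.isStrictlyPositive.spectrum_pos hx
    exact ⟨r, hr, by rwa [← Algebra.algebraMap_eq_smul_one]⟩

theorem Matrix.IsHermitian.exists_le_smul_one {A : Matrix m m ℂ} (hA : A.IsHermitian) :
    ∃ r : ℝ, 0 < r ∧ A ≤ r • (1 : Matrix m m ℂ) := by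
  have hs : IsSelfAdjoint A := hA
  obtain ⟨r, hr⟩ := A.finite_real_spectrum.bddAbove
  refine ⟨max r 1, by positivity, ?_⟩
  rw [← Algebra.algebraMap_eq_smul_one]
  exact le_algebraMap_of_spectrum_le fun x hx => (hr hx).trans (le_max_left _ _)

/-- The pinching inequality `M ≤ (1 + η) P M P + (1 + η⁻¹) (1 - P) M (1 - P)`. -/
theorem Matrix.PosSemidef.le_pinching {M P : Matrix m m ℂ} (hM : M.PosSemidef)
    (hP : P.IsHermitian) {η : ℝ} (hη : 0 < η) :
    M ≤ (1 + η) • (P * M * P) + (1 + η⁻¹) • ((1 - P) * M * (1 - P)) := by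
  have hs : (√η : ℝ) ≠ 0 := (Real.sqrt_pos.2 hη).ne'
  -- The weights are chosen so that the cross terms of `K M K` are exactly those of `M` with
  -- opposite sign.
  set K : Matrix m m ℂ := √η • P - (√η)⁻¹ • (1 - P) with hK
  have hKh : Kᴴ = K := by
    simp [hK, Matrix.conjTranspose_sub, Matrix.conjTranspose_smul, hP.eq]
  suffices h : (1 + η) • (P * M * P) + (1 + η⁻¹) • ((1 - P) * M * (1 - P)) - M = Kᴴ * M * K by
    rw [Matrix.le_iff, h]
    exact hM.conjTranspose_mul_mul_same K
  rw [hKh, hK]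
  have h1 : √η * √η = η := Real.mul_self_sqrt hη.le
  have h2 : (√η)⁻¹ * (√η)⁻¹ = η⁻¹ := by rw [← mul_inv, h1]
  simp only [sub_mul, mul_sub, Matrix.smul_mul, Matrix.mul_smul, smul_smul, h1, h2,
    mul_inv_cancel₀ hs, inv_mul_cancel₀ hs, smul_sub, add_smul, one_smul, one_mul, mul_one]
  abel

/-- Jensen's inequality for operator anti-monotone functions and an isometry, in a form that does
not presuppose continuity. -/
theorem OperatorAntiMonotone.cfc_le_conjTranspose_mul_cfc_mul {f : ℝ → ℝ}
    (hf : OperatorAntiMonotone f) {M : Matrix m m ℂ} {N : Matrix n n ℂ} {W : Matrix m n ℂ}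
    (hW : Wᴴ * W = 1) (hM : M.PosDef) (h : Wᴴ * M * W ≤ N) {η : ℝ} (hη : 0 < η) :
    cfc f ((1 + η) • N) ≤ Wᴴ * cfc f M * W := by
  have hWi : Function.Injective W.mulVec := fun x y hxy => by
    have := congrArg (Wᴴ *ᵥ ·) hxy
    simpa [Matrix.mulVec_mulVec, hW] using this
  have hN : N.PosDef := (hM.conjTranspose_mul_mul_same hWi).of_le h
  have hN' : ((1 + η) • N).IsHermitian := (hN.posSemidef.smul (by positivity)).1
  obtain ⟨c, hc, hMc⟩ := hM.1.exists_le_smul_one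
  set P := W * Wᴴ with hP
  have hPh : P.IsHermitian := Matrix.isHermitian_mul_conjTranspose_self W
  have hQh : (1 - P)ᴴ = 1 - P := by simp [hPh.eq]
  have hQW : (1 - P) * W = 0 := by
    rw [Matrix.sub_mul, hP, Matrix.mul_assoc, hW]; simp
  -- `K` dominates `M` by pinching and leaves the range of `W` invariant, acting there as `(1 + η)
  -- N`. Compressing `f(K) ≤ f(M)` by `W` therefore gives the claim.
  set K := W * ((1 + η) • N) * Wᴴ + ((1 + η⁻¹) * c) • ((1 - P) * (1 - P)) with hK
  have hMK : M ≤ K := by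
    refine (hM.posSemidef.le_pinching hPh hη).trans (add_le_add ?_ ?_)
    · have := Matrix.conjTranspose_mul_mul_mono h Wᴴ
      rw [Matrix.conjTranspose_conjTranspose] at this
      rw [Matrix.mul_smul, Matrix.smul_mul]
      refine Matrix.smul_mono ?_ (by positivity)
      convert this using 1
      simp only [hP, Matrix.mul_assoc]
    · have := Matrix.conjTranspose_mul_mul_mono hMc (1 - P)
      rw [hQh, Matrix.mul_smul, Matrix.smul_mul, Matrix.mul_one] at this
      rw [mul_smul]
      exact Matrix.smul_mono this (by positivity)
  have hKW : K * W = W * ((1 + η) • N) := by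
    rw [hK, Matrix.add_mul, Matrix.mul_assoc, hW, Matrix.mul_one, Matrix.smul_mul,
      Matrix.mul_assoc, hQW]
    simp
  have h1 := hf.cfc_le_cfc hM hMK
  have h2 := Matrix.conjTranspose_mul_mul_mono h1 W
  rwa [Matrix.mul_assoc, Matrix.cfc_mul_eq_mul_cfc f (hM.of_le hMK).1 hN' hKW,
    ← Matrix.mul_assoc, hW, Matrix.one_mul] at h2

end FunctionalCalculus

/-! ### Right-continuity deduced from operator anti-monotonicity. -/

section Continuity

theorem Matrix.cfc_smul_one {m : Type*} [Fintype m] [DecidableEq m] (f : ℝ → ℝ) (r : ℝ) :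
    cfc f (r • (1 : Matrix m m ℂ)) = f r • (1 : Matrix m m ℂ) := by
  simpa only [Algebra.algebraMap_eq_smul_one] using cfc_algebraMap (A := Matrix m m ℂ) r f

theorem Matrix.posDef_smul_one {m : Type*} [Fintype m] [DecidableEq m] {r : ℝ} (hr : 0 < r) :
    (r • (1 : Matrix m m ℂ)).PosDef := Matrix.PosDef.one.smul hr

theorem Matrix.smul_one_le_smul_one {m : Type*} [Fintype m] [DecidableEq m] [Nonempty m]
    {r s : ℝ} : r • (1 : Matrix m m ℂ) ≤ s • (1 : Matrix m m ℂ) ↔ r ≤ s := by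
  rw [Matrix.le_iff, ← sub_smul]
  constructor
  · intro h
    have := h.diag_nonneg (i := Classical.arbitrary m)
    simpa [Complex.le_def] using this
  · intro h
    exact Matrix.PosSemidef.one.smul (sub_nonneg.2 h)

theorem OperatorAntiMonotone.antitoneOn {f : ℝ → ℝ} (hf : OperatorAntiMonotone f) :
    AntitoneOn f (Set.Ioi 0) := by
  intro x hx y _ hxy
  have := hf.cfc_le_cfc (m := Fin 1) (Matrix.posDef_smul_one hx)
    (Matrix.smul_one_le_smul_one.2 hxy)
  rwa [Matrix.cfc_smul_one, Matrix.cfc_smul_one, Matrix.smul_one_le_smul_one] at this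

/-- Jensen for `diag(x, y)` and the unit vector `(1, 1)/√2`. The strict inequality leaves room for
the factor `1 + η`. -/
theorem OperatorAntiMonotone.le_midpoint {f : ℝ → ℝ} (hf : OperatorAntiMonotone f)
    {x y z : ℝ} (hx : 0 < x) (hy : 0 < y) (hz : (x + y) / 2 < z) :
    f z ≤ (f x + f y) / 2 := by
  let D : (ℝ × ℝ) → Matrix (Fin 2) (Fin 2) ℂ := fun p => Matrix.diagonal ![(p.1 : ℂ), (p.2 : ℂ)]
  let W : Matrix (Fin 2) (Fin 1) ℂ := Matrix.of fun _ _ => ((√2)⁻¹ : ℝ)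
  have hs : ((√2 : ℝ) : ℂ)⁻¹ * ((√2 : ℝ) : ℂ)⁻¹ = 2⁻¹ := by
    rw [← mul_inv, ← Complex.ofReal_mul, Real.mul_self_sqrt (by norm_num)]; simp
  have hWD : ∀ p, Wᴴ * D p * W = ((p.1 + p.2) / 2) • (1 : Matrix (Fin 1) (Fin 1) ℂ) := by
    intro p
    ext i j
    fin_cases i; fin_cases j
    simp [W, D, Matrix.mul_apply, Fin.sum_univ_two, Matrix.diagonal]
    linear_combination ((p.1 : ℂ) + p.2) * hs
  have hD1 : D (1, 1) = 1 := by ext i j; fin_cases i <;> fin_cases j <;> simp [D]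
  have hW : Wᴴ * W = 1 := by
    have := hWD (1, 1)
    rw [hD1, Matrix.mul_one] at this
    simpa using this
  have hpos : (D (x, y)).PosDef := by
    refine Matrix.PosDef.diagonal fun i => ?_
    fin_cases i <;> simp [hx, hy]
  have hcfc : cfc f (D (x, y)) = D (f x, f y) := by
    have e : ∀ (i : Fin 2) (t : ℝ), D (x, y) i i = t → D (f x, f y) i i = f t →
        ∀ j, cfc f (D (x, y)) j i = D (f x, f y) j i := by
      intro i t ht ht' j
      let V : Matrix (Fin 2) (Fin 1) ℂ := Matrix.of fun k _ => if k = i then 1 else 0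
      have hV : ∀ A : Matrix (Fin 2) (Fin 2) ℂ, ∀ k l, (A * V) k l = A k i := by
        intro A k l
        simp [Matrix.mul_apply, V]
      have h1 : D (x, y) * V = V * (t • (1 : Matrix (Fin 1) (Fin 1) ℂ)) := by
        ext k l
        rw [hV, Matrix.mul_smul, Matrix.mul_one, Matrix.smul_apply]
        by_cases hk : k = i
        · subst hk; simp [V, ht]
        · simp [D, V, hk]
      have h2 := Matrix.cfc_mul_eq_mul_cfc f hpos.1 (Matrix.PosSemidef.one.1.smul
        (IsSelfAdjoint.all t)) h1
      rw [Matrix.cfc_smul_one, Matrix.mul_smul, Matrix.mul_one] at h2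
      have h3 := congrFun (congrFun h2 j) 0
      rw [hV] at h3
      rw [h3]
      by_cases hk : j = i
      · subst hk; simp [V, ht']
      · simp [D, V, hk]
    ext j i
    fin_cases i
    · exact e 0 x (by simp [D]) (by simp [D]) j
    · exact e 1 y (by simp [D]) (by simp [D]) j
  have hη : 0 < z / ((x + y) / 2) - 1 := by
    rw [sub_pos, lt_div_iff₀ (by positivity)]; linarith
  have := hf.cfc_le_conjTranspose_mul_cfc_mul hW hpos (hWD (x, y)).le hη
  rw [hcfc, hWD, smul_smul, Matrix.cfc_smul_one, Matrix.smul_one_le_smul_one] at this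
  convert this using 2
  field_simp
  ring

/-- An operator anti-monotone function is right-continuous along dilations. -/
theorem OperatorAntiMonotone.exists_sub_le {f : ℝ → ℝ} (hf : OperatorAntiMonotone f)
    {x e : ℝ} (hx : 0 < x) (he : 0 < e) : ∃ z, x < z ∧ f x - e ≤ f z := by
  by_contra! hcon
  -- A jump of size `e` just to the right of `x` propagates to the left: the midpoint of `y` and `x
  -- + (x - y)/4` lies below `(3x + y)/4 < x`, so the bound at that point forces `f y` up by another
  -- `e`. Then `f (x / 2)` would exceed every bound.
  have key : ∀ n : ℕ, ∀ y, 0 < y → y < x → f x + n * e ≤ f y := by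
    intro n
    induction n with
    | zero =>
      intro y hy hyx
      simpa using hf.antitoneOn hy hx hyx.le
    | succ n ih =>
      intro y hy hyx
      have h1 := ih ((3 * x + y) / 4) (by linarith) (by linarith)
      have h2 := hf.le_midpoint (x := y) (y := x + (x - y) / 4) (z := (3 * x + y) / 4) hy
        (by linarith) (by linarith)
      have h3 := hcon (x + (x - y) / 4) (by linarith)
      have : (0 : ℝ) ≤ n * e := by positivity
      push_cast
      linarith
  obtain ⟨n, hn⟩ := exists_nat_gt ((f (x / 2) - f x) / e)
  have := key n (x / 2) (by linarith) (by linarith)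
  rw [div_lt_iff₀ he] at hn
  linarith

variable {m : Type*} [Fintype m] [DecidableEq m]

/-- Scalar right-continuity at each of the finitely many eigenvalues provides a common `η`. -/
theorem OperatorAntiMonotone.exists_cfc_sub_le {f : ℝ → ℝ} (hf : OperatorAntiMonotone f)
    {T : Matrix m m ℂ} (hT : T.PosDef) {e : ℝ} (he : 0 < e) :
    ∃ η : ℝ, 0 < η ∧ cfc f T - e • (1 : Matrix m m ℂ) ≤ cfc f ((1 + η) • T) := by
  have hs : IsSelfAdjoint T := hT.1
  have hpos : ∀ x ∈ spectrum ℝ T, 0 < x := fun x hx => hT.isStrictlyPositive.spectrum_pos hx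
  have h1 : ∀ x ∈ spectrum ℝ T, ∀ᶠ η in nhdsWithin (0 : ℝ) (Set.Ioi 0),
      f x - e ≤ f ((1 + η) * x) := by
    intro x hx
    have hx0 := hpos x hx
    obtain ⟨z, hz, hfz⟩ := hf.exists_sub_le hx0 he
    have hlim : Filter.Tendsto (fun η : ℝ => (1 + η) * x) (nhdsWithin 0 (Set.Ioi 0)) (nhds x) := by
      refine tendsto_nhdsWithin_of_tendsto_nhds ?_
      have : Continuous fun η : ℝ => (1 + η) * x := by fun_prop
      simpa using this.tendsto 0
    filter_upwards [hlim.eventually (gt_mem_nhds hz), self_mem_nhdsWithin] with η h1 h2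
    have h2' : 0 < η := h2
    exact hfz.trans (hf.antitoneOn (Set.mem_Ioi.2 (by positivity)) (hx0.trans hz) h1.le)
  obtain ⟨η, h2, hη⟩ := (((Filter.eventually_all_finite T.finite_real_spectrum).2 h1).and
    self_mem_nhdsWithin).exists
  refine ⟨η, hη, ?_⟩
  have hc := Matrix.continuousOn_real_spectrum (A := T)
  rw [← cfc_comp_const_mul (1 + η) f T ((T.finite_real_spectrum.image _).continuousOn _),
    ← Algebra.algebraMap_eq_smul_one, ← cfc_const e T, ← cfc_sub f (fun _ => e) T (hc _) (hc _)]
  exact cfc_mono h2 (hc _) (hc _)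

end Continuity

/-! ### Algebra of the partial trace. -/

section PartialTrace

variable {a b : Type*} [Fintype b]

theorem partialTraceRight_add (M N : Matrix (a × b) (a × b) ℂ) :
    partialTraceRight (M + N) = partialTraceRight M + partialTraceRight N := by
  ext i j; simp [partialTraceRight, Finset.sum_add_distrib]

theorem partialTraceRight_smul (r : ℝ) (M : Matrix (a × b) (a × b) ℂ) :
    partialTraceRight (r • M) = r • partialTraceRight M := by
  ext i j; simp [partialTraceRight, Finset.mul_sum]

theorem Matrix.PosSemidef.partialTraceRight {M : Matrix (a × b) (a × b) ℂ} (hM : M.PosSemidef) :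
    (partialTraceRight M).PosSemidef := by
  have : _root_.partialTraceRight M = ∑ k : b, M.submatrix (·, k) (·, k) := by
    ext i j; simp [_root_.partialTraceRight, Matrix.sum_apply]
  rw [this]
  exact Matrix.posSemidef_sum _ fun k _ => hM.submatrix _

theorem trace_partialTraceRight [Fintype a] (M : Matrix (a × b) (a × b) ℂ) :
    (partialTraceRight M).trace = M.trace := by
  simp [Matrix.trace, partialTraceRight, Fintype.sum_prod_type]

variable [DecidableEq b]

theorem partialTraceRight_kronecker_one (T : Matrix a a ℂ) :
    partialTraceRight (T ⊗ₖ (1 : Matrix b b ℂ)) = (Fintype.card b : ℝ) • T := by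
  ext i j; simp [partialTraceRight, Matrix.kroneckerMap_apply, Finset.card_univ]

theorem partialTraceRight_kronecker_mul_mul [Fintype a] (C D : Matrix a a ℂ)
    (M : Matrix (a × b) (a × b) ℂ) :
    partialTraceRight ((C ⊗ₖ (1 : Matrix b b ℂ)) * M * (D ⊗ₖ (1 : Matrix b b ℂ))) =
      C * partialTraceRight M * D := by
  ext i j
  simp only [partialTraceRight, Matrix.of_apply, Matrix.mul_apply, Fintype.sum_prod_type,
    Matrix.kroneckerMap_apply, Matrix.one_apply, mul_ite, mul_one, mul_zero, ite_mul, zero_mul,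
    Finset.sum_ite_eq, Finset.sum_ite_eq', Finset.mem_univ, if_true, Finset.mul_sum,
    Finset.sum_mul]
  rw [Finset.sum_comm]
  refine Finset.sum_congr rfl fun x _ => ?_
  rw [Finset.sum_comm]

end PartialTrace

/-! ### The isometry from the marginal system to the composite one. -/

section Dilation

variable {a b : Type*} [Fintype a] [DecidableEq a] [Fintype b] [DecidableEq b]

theorem phiVec_apply (X : Matrix a a ℂ) (p : a × a) : phiVec X p = CFC.sqrt X p.1 p.2 := by
  simp [phiVec, gammaVec, Matrix.mulVec, dotProduct, Fintype.sum_prod_type,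
    Matrix.kroneckerMap_apply, Matrix.one_apply]

variable (a b) in
/-- The embedding `|i⟩|j⟩ ↦ ∑ k, |i k⟩|j k⟩`, i.e. tensoring with the unnormalized maximally
entangled vector on two copies of the second factor. -/
def gammaEmbedding : Matrix ((a × b) × (a × b)) (a × a) ℂ :=
  Matrix.of fun p q => if p.1.1 = q.1 ∧ p.2.1 = q.2 ∧ p.1.2 = p.2.2 then 1 else 0

theorem mul_gammaEmbedding_apply {l : Type*} (C : Matrix l ((a × b) × (a × b)) ℂ) (p : l)
    (q : a × a) : (C * gammaEmbedding a b) p q = ∑ t, C p ((q.1, t), (q.2, t)) := by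
  simp only [Matrix.mul_apply, gammaEmbedding, Matrix.of_apply, mul_ite, mul_one, mul_zero,
    Fintype.sum_prod_type, ite_and]
  rw [Finset.sum_eq_single q.1]
  · refine Finset.sum_congr rfl fun x _ => ?_
    rw [Finset.sum_eq_single q.2]
    · simp
    · intro y _ hy; simp [hy]
    · simp
  · intro y _ hy; simp [hy]
  · simp

theorem conjTranspose_gammaEmbedding_mul_mul_apply
    (C : Matrix ((a × b) × (a × b)) ((a × b) × (a × b)) ℂ)
    (p q : a × a) :
    ((gammaEmbedding a b)ᴴ * C * gammaEmbedding a b) p q =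
      ∑ t, ∑ s, C ((p.1, s), (p.2, s)) ((q.1, t), (q.2, t)) := by
  rw [mul_gammaEmbedding_apply]
  refine Finset.sum_congr rfl fun t _ => ?_
  rw [← Matrix.conjTranspose_conjTranspose ((gammaEmbedding a b)ᴴ * C),
    Matrix.conjTranspose_mul, Matrix.conjTranspose_conjTranspose, Matrix.conjTranspose_apply,
    mul_gammaEmbedding_apply]
  simp

theorem gammaEmbedding_conj_kronecker_one (G : Matrix (a × b) (a × b) ℂ) :
    (gammaEmbedding a b)ᴴ * (G ⊗ₖ (1 : Matrix (a × b) (a × b) ℂ)) * gammaEmbedding a b =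
      partialTraceRight G ⊗ₖ (1 : Matrix a a ℂ) := by
  ext p q
  rw [conjTranspose_gammaEmbedding_mul_mul_apply]
  simp [Matrix.kroneckerMap_apply, Matrix.one_apply, partialTraceRight, ite_and]

/-- The identity on the first copy of `B` forces equal indices on the second, which leaves the
partial trace of `Z`. -/
theorem gammaEmbedding_conj_kronecker_transpose (T : Matrix a a ℂ)
    (Z : Matrix (a × b) (a × b) ℂ) :
    (gammaEmbedding a b)ᴴ * ((T ⊗ₖ (1 : Matrix b b ℂ)) ⊗ₖ Zᵀ) * gammaEmbedding a b =
      T ⊗ₖ (partialTraceRight Z)ᵀ := by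
  ext p q
  rw [conjTranspose_gammaEmbedding_mul_mul_apply]
  simp [Matrix.kroneckerMap_apply, Matrix.one_apply, partialTraceRight, Finset.mul_sum]

theorem gammaEmbedding_mulVec_phiVec {X : Matrix (a × b) (a × b) ℂ} {ρ : Matrix a a ℂ}
    {S : Matrix (a × b) (a × b) ℂ} (hS : S * (CFC.sqrt ρ ⊗ₖ (1 : Matrix b b ℂ)) = CFC.sqrt X) :
    ((S ⊗ₖ (1 : Matrix (a × b) (a × b) ℂ)) * gammaEmbedding a b) *ᵥ phiVec ρ = phiVec X := by
  ext p
  rw [phiVec_apply, ← hS, Matrix.mulVec, dotProduct]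
  simp only [mul_gammaEmbedding_apply, phiVec_apply]
  simp only [Matrix.mul_apply, Matrix.kroneckerMap_apply, Fintype.sum_prod_type, Matrix.one_apply,
    Prod.ext_iff, ite_and]
  simp only [mul_ite, mul_one, mul_zero, Finset.sum_ite_irrel, Finset.sum_const_zero,
    Finset.sum_ite_eq, Finset.sum_ite_eq', Finset.mem_univ, if_true, ite_mul, zero_mul]

/-- A purification-type operator intertwining `ρ^{1/2}` and `X^{1/2}`, where `ρ` is the partial
trace of `X`. -/
theorem Matrix.PosSemidef.exists_partialTraceRight_eq_one [Nonempty b]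
    {X : Matrix (a × b) (a × b) ℂ} (hX : X.PosSemidef) :
    ∃ S : Matrix (a × b) (a × b) ℂ, _root_.partialTraceRight (Sᴴ * S) = 1 ∧
      S * (CFC.sqrt (_root_.partialTraceRight X) ⊗ₖ (1 : Matrix b b ℂ)) = CFC.sqrt X := by
  set ρ := _root_.partialTraceRight X with hρ
  have hρp : ρ.PosSemidef := hX.partialTraceRight
  have hρs : IsSelfAdjoint ρ := hρp.1
  have hc := Matrix.continuousOn_real_spectrum (A := ρ)
  have hnn : ∀ x ∈ spectrum ℝ ρ, 0 ≤ x := fun x hx => spectrum_nonneg_of_nonneg hρp.nonneg hx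
  set g : ℝ → ℝ := fun x => if x = 0 then 1 else 0
  -- Inverse square root on the support of `ρ`; its value at `0` is immaterial.
  set r : ℝ → ℝ := fun x => if x = 0 then 1 else (√x)⁻¹
  set P := cfc g ρ
  set R := cfc r ρ
  have hsq : CFC.sqrt ρ = cfc Real.sqrt ρ := by
    rw [CFC.sqrt_eq_real_sqrt ρ hρp.nonneg, cfcₙ_eq_cfc]
  have hP : Pᴴ = P := cfc_predicate (R := ℝ) (p := IsSelfAdjoint) g ρ
  have hR : Rᴴ = R := cfc_predicate (R := ℝ) (p := IsSelfAdjoint) r ρ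
  have hPP : P * P = P := by
    rw [← cfc_mul g g ρ (hc _) (hc _)]
    exact cfc_congr fun x _ => by by_cases h : x = 0 <;> simp [g, h]
  have hPs : P * CFC.sqrt ρ = 0 := by
    rw [hsq, ← cfc_mul g _ ρ (hc _) (hc _), ← cfc_zero ℝ ρ]
    exact cfc_congr fun x _ => by by_cases h : x = 0 <;> simp [g, h]
  have hss : CFC.sqrt ρ * CFC.sqrt ρ = ρ := CFC.sqrt_mul_sqrt_self ρ hρp.nonneg
  have hRs : R * CFC.sqrt ρ = 1 - P := by
    rw [hsq, ← cfc_mul r _ ρ (hc _) (hc _), ← cfc_one ℝ ρ, ← cfc_sub _ _ ρ (hc _) (hc _)]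
    refine cfc_congr fun x hx => ?_
    by_cases h : x = 0
    · simp [g, h]
    · simp [g, r, h, Real.sqrt_ne_zero'.2 ((hnn x hx).lt_of_ne' h)]
  have hsh : (CFC.sqrt ρ)ᴴ = CFC.sqrt ρ := (Matrix.nonneg_iff_posSemidef.1 (CFC.sqrt_nonneg ρ)).1
  have hsR : CFC.sqrt ρ * R = 1 - P := by
    simpa [Matrix.conjTranspose_mul, hR, hsh, hP] using congrArg Matrix.conjTranspose hRs
  have hRρR : R * ρ * R = 1 - P := by
    rw [← hss, ← mul_assoc, hRs, mul_assoc, hsR]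
    simp [sub_mul, mul_sub, hPP]
  have hPρP : P * ρ * P = 0 := by rw [← hss, ← mul_assoc, hPs]; simp
  have hXs : CFC.sqrt X * CFC.sqrt X = X := CFC.sqrt_mul_sqrt_self X hX.nonneg
  have hXh : (CFC.sqrt X)ᴴ = CFC.sqrt X := (Matrix.nonneg_iff_posSemidef.1 (CFC.sqrt_nonneg X)).1
  have hkh : ∀ C : Matrix a a ℂ, Cᴴ = C → (C ⊗ₖ (1 : Matrix b b ℂ))ᴴ = C ⊗ₖ (1 : Matrix b b ℂ) :=
    fun C hC => by rw [Matrix.conjTranspose_kronecker, hC, Matrix.conjTranspose_one]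
  have hkm : ∀ C D : Matrix a a ℂ, (C ⊗ₖ (1 : Matrix b b ℂ)) * (D ⊗ₖ (1 : Matrix b b ℂ)) =
      (C * D) ⊗ₖ (1 : Matrix b b ℂ) := fun C D => by
    rw [← Matrix.mul_kronecker_mul, mul_one]
  -- `X` vanishes on `ker ρ ⊗ B`, because `(P ⊗ 1) X (P ⊗ 1)` has trace `Tr (P ρ P) = 0`.
  have hXP : CFC.sqrt X * (P ⊗ₖ (1 : Matrix b b ℂ)) = 0 := by
    rw [← Matrix.trace_conjTranspose_mul_self_eq_zero_iff, Matrix.conjTranspose_mul, hXh,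
      hkh P hP, ← mul_assoc, mul_assoc _ (CFC.sqrt X) (CFC.sqrt X), hXs, ← trace_partialTraceRight,
      partialTraceRight_kronecker_mul_mul, hPρP, Matrix.trace_zero]
  have hPX : (P ⊗ₖ (1 : Matrix b b ℂ)) * CFC.sqrt X = 0 := by
    simpa [Matrix.conjTranspose_mul, hkh P hP, hXh] using congrArg Matrix.conjTranspose hXP
  set d : ℝ := (Fintype.card b : ℝ) with hd
  have hd0 : 0 < d := by positivity
  set c : ℝ := (√d)⁻¹
  have hcc : c * c * d = 1 := by
    rw [← mul_inv, Real.mul_self_sqrt hd0.le, inv_mul_cancel₀ hd0.ne']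
  -- The first summand contributes `1 - P` to `Tr_B (Sᴴ S)`. The second supplies the missing `P`, as
  -- `Tr_B (P ⊗ 1) = d P` and `c² d = 1`, and it is annihilated by `ρ^{1/2} ⊗ 1`.
  refine ⟨CFC.sqrt X * (R ⊗ₖ 1) + c • (P ⊗ₖ 1), ?_, ?_⟩
  · have : (CFC.sqrt X * (R ⊗ₖ (1 : Matrix b b ℂ)) + c • (P ⊗ₖ 1))ᴴ *
        (CFC.sqrt X * (R ⊗ₖ 1) + c • (P ⊗ₖ 1)) =
        (R ⊗ₖ 1) * X * (R ⊗ₖ 1) + (c * c) • (P ⊗ₖ (1 : Matrix b b ℂ)) := by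
      rw [Matrix.conjTranspose_add, Matrix.conjTranspose_mul, Matrix.conjTranspose_smul, hXh,
        hkh R hR, hkh P hP, star_trivial, add_mul, mul_add, mul_add]
      rw [mul_assoc _ (CFC.sqrt X), ← mul_assoc (CFC.sqrt X), hXs, Matrix.mul_smul,
        mul_assoc _ (CFC.sqrt X), hXP, Matrix.smul_mul, ← mul_assoc _ (CFC.sqrt X), hPX,
        Matrix.smul_mul, Matrix.mul_smul, hkm, hPP]
      simp [mul_assoc, smul_smul]
    rw [this, partialTraceRight_add, partialTraceRight_kronecker_mul_mul, ← hρ, hRρR,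
      partialTraceRight_smul, partialTraceRight_kronecker_one, smul_smul, hcc]
    simp
  · rw [add_mul, mul_assoc, hkm, hRs, Matrix.smul_mul, hkm, hPs]
    have : (1 - P) ⊗ₖ (1 : Matrix b b ℂ) = 1 - P ⊗ₖ 1 := by
      rw [eq_sub_iff_add_eq, ← Matrix.add_kronecker, sub_add_cancel, Matrix.one_kronecker_one]
    rw [this, mul_sub, hXP]
    simp

/-- If `S T Sᴴ ≤ D` then `Sᴴ D⁻¹ S ≤ T⁻¹`. -/
theorem Matrix.PosDef.conjTranspose_mul_inv_mul_le {m : Type*} [Fintype m] [DecidableEq m]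
    {T D S : Matrix m m ℂ} (hT : T.PosDef) (hD : D.PosDef) (h : S * T * Sᴴ ≤ D) :
    Sᴴ * D⁻¹ * S ≤ T⁻¹ := by
  have := hT.inv.isUnit.invertible
  have := hD.isUnit.invertible
  -- Both inequalities are Schur complement criteria for positivity of the block matrix `[[T⁻¹, Sᴴ],
  -- [S, D]]`.
  have h1 := (Matrix.PosDef.fromBlocks₁₁ Sᴴ D hT.inv).2 (by
    rw [Matrix.conjTranspose_conjTranspose, Matrix.nonsing_inv_nonsing_inv _
      ((Matrix.isUnit_iff_isUnit_det _).1 hT.isUnit)]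
    exact Matrix.le_iff.1 h)
  have h2 := (Matrix.PosDef.fromBlocks₂₂ T⁻¹ Sᴴ hD).1 h1
  rw [Matrix.conjTranspose_conjTranspose] at h2
  exact Matrix.le_iff.2 h2

end Dilation

/-! ### Regularization of `Y` by its kernel projection. -/

section KernelProjection

variable {s : Type*} [Fintype s] [DecidableEq s]

theorem isStarProjection_kernelProj (Y : Matrix s s ℂ) : IsStarProjection (kernelProj Y) := by
  have h := isStarProjection_starProjection
    (U := LinearMap.ker (Matrix.toEuclideanCLM (n := s) (𝕜 := ℂ) Y).toLinearMap)
  exact h.map (Matrix.toEuclideanCLM (n := s) (𝕜 := ℂ)).symm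

theorem posSemidef_kernelProj (Y : Matrix s s ℂ) : (kernelProj Y).PosSemidef := by
  have h := isStarProjection_kernelProj Y
  have := Matrix.posSemidef_conjTranspose_mul_self (kernelProj Y)
  rwa [← Matrix.star_eq_conjTranspose, h.isSelfAdjoint.star_eq, h.isIdempotentElem.eq] at this

theorem kernelProj_mulVec {Y : Matrix s s ℂ} {x : s → ℂ} (hx : Y *ᵥ x = 0) :
    kernelProj Y *ᵥ x = x := by
  have h : WithLp.toLp 2 x ∈
      LinearMap.ker (Matrix.toEuclideanCLM (n := s) (𝕜 := ℂ) Y).toLinearMap := by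
    rw [LinearMap.mem_ker]
    ext i
    exact congrFun hx i
  have h2 := Submodule.starProjection_eq_self_iff.2 h
  have h3 : Matrix.toEuclideanCLM (n := s) (𝕜 := ℂ) (kernelProj Y) =
      (LinearMap.ker (Matrix.toEuclideanCLM (n := s) (𝕜 := ℂ) Y).toLinearMap).starProjection :=
    StarAlgEquiv.apply_symm_apply _ _
  rw [← h3] at h2
  exact congrArg WithLp.ofLp h2

theorem Matrix.PosSemidef.posDef_add_smul_kernelProj {Y : Matrix s s ℂ} (hY : Y.PosSemidef)
    {ε : ℝ} (hε : 0 < ε) : (Y + ε • kernelProj Y).PosDef := by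
  have hK := (posSemidef_kernelProj Y).smul hε.le
  have hYK := hY.add hK
  refine .of_dotProduct_mulVec_pos hYK.1 fun x hx => ?_
  refine lt_of_le_of_ne (hYK.dotProduct_mulVec_nonneg x) fun h0 => hx ?_
  rw [Matrix.add_mulVec, dotProduct_add] at h0
  have h1 := hY.dotProduct_mulVec_nonneg x
  have h2 := hK.dotProduct_mulVec_nonneg x
  obtain ⟨h3, h4⟩ := (add_eq_zero_iff_of_nonneg h1 h2).1 h0.symm
  rw [hY.dotProduct_mulVec_zero_iff] at h3
  rw [hK.dotProduct_mulVec_zero_iff, Matrix.smul_mulVec, kernelProj_mulVec h3] at h4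
  exact (smul_eq_zero.1 h4).resolve_left hε.ne'

end KernelProjection

/-! ### Feasible operators on the composite system and the final estimate. -/

section Monotonicity

theorem Matrix.kronecker_mono_right {m n : Type*} [Finite m] [Finite n] {A : Matrix m m ℂ}
    {B C : Matrix n n ℂ} (hA : A.PosSemidef) (h : B ≤ C) : A ⊗ₖ B ≤ A ⊗ₖ C := by
  have e : A ⊗ₖ C = A ⊗ₖ (C - B) + A ⊗ₖ B := by rw [← Matrix.kronecker_add, sub_add_cancel]
  rw [Matrix.le_iff, e, add_sub_cancel_right]
  exact hA.kronecker (Matrix.le_iff.1 h)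

theorem Matrix.kronecker_mono_left {m n : Type*} [Finite m] [Finite n] {A B : Matrix m m ℂ}
    {C : Matrix n n ℂ} (hC : C.PosSemidef) (h : A ≤ B) : A ⊗ₖ C ≤ B ⊗ₖ C := by
  have e : B ⊗ₖ C = (B - A) ⊗ₖ C + A ⊗ₖ C := by rw [← Matrix.add_kronecker, sub_add_cancel]
  rw [Matrix.le_iff, e, add_sub_cancel_right]
  exact (Matrix.le_iff.1 h).kronecker hC

theorem Matrix.transpose_mono {m : Type*} {A B : Matrix m m ℂ} (h : A ≤ B) : Aᵀ ≤ Bᵀ := by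
  rw [Matrix.le_iff] at h ⊢
  simpa using h.transpose

theorem Matrix.re_dotProduct_mulVec_mono {m : Type*} [Fintype m] {A B : Matrix m m ℂ}
    (h : A ≤ B) (v : m → ℂ) :
    (star v ⬝ᵥ (A *ᵥ v)).re ≤ (star v ⬝ᵥ (B *ᵥ v)).re := by
  have := (Matrix.le_iff.1 h).dotProduct_mulVec_nonneg v
  rw [Matrix.sub_mulVec, dotProduct_sub, sub_nonneg] at this
  exact (Complex.le_def.1 this).1

/-- Regularizing `Y` by a small multiple of its kernel projection barely changes its partial
trace relative to a positive definite regularization of the partial trace. -/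
theorem exists_partialTraceRight_add_smul_le {a b : Type*} [Fintype a]
    [DecidableEq a] [Fintype b] {Y K : Matrix (a × b) (a × b) ℂ} {Z : Matrix a a ℂ}
    (hK : K.PosSemidef) (hZ : Z.PosDef) (hYZ : partialTraceRight Y ≤ Z) {θ : ℝ} (hθ : 0 < θ) :
    ∃ ε : ℝ, 0 < ε ∧ partialTraceRight (Y + ε • K) ≤ (1 + θ) • Z := by
  obtain ⟨r, hr, hrZ⟩ := hZ.exists_pos_smul_one_le
  obtain ⟨c, hc, hKc⟩ := hK.partialTraceRight.1.exists_le_smul_one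
  -- With `Tr_B K ≤ c` and `r ≤ Z`, this `ε` keeps the perturbation below `θ Z`.
  refine ⟨θ * r / c, by positivity, ?_⟩
  rw [partialTraceRight_add, partialTraceRight_smul, add_smul, one_smul]
  refine add_le_add hYZ ?_
  calc (θ * r / c) • partialTraceRight K ≤ (θ * r / c) • c • (1 : Matrix a a ℂ) :=
        Matrix.smul_mono hKc (by positivity)
    _ = θ • r • (1 : Matrix a a ℂ) := by rw [smul_smul, smul_smul, div_mul_cancel₀ _ hc.ne']
    _ ≤ θ • Z := Matrix.smul_mono hrZ hθ.le

variable {a b : Type*} [Fintype a] [DecidableEq a] [Fintype b] [DecidableEq b]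

/-- The isometry attached to `S` compresses `τ'⁻¹ ⊗ Zᵀ` below `τ⁻¹ ⊗ (Tr_B Z)ᵀ` whenever
`S (τ ⊗ 1) Sᴴ ≤ τ'`. -/
theorem conj_kronecker_transpose_le {S τ' Z : Matrix (a × b) (a × b) ℂ} {τ : Matrix a a ℂ}
    (hτ : τ.PosDef) (hτ' : τ'.PosDef) (hZ : Z.PosSemidef)
    (h : S * (τ ⊗ₖ (1 : Matrix b b ℂ)) * Sᴴ ≤ τ') :
    ((S ⊗ₖ (1 : Matrix (a × b) (a × b) ℂ)) * gammaEmbedding a b)ᴴ * (τ'⁻¹ ⊗ₖ Zᵀ) *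
      ((S ⊗ₖ (1 : Matrix (a × b) (a × b) ℂ)) * gammaEmbedding a b) ≤
      τ⁻¹ ⊗ₖ (partialTraceRight Z)ᵀ := by
  have h1 := (hτ.kronecker (Matrix.PosDef.one (n := b))).conjTranspose_mul_inv_mul_le hτ' h
  rw [Matrix.inv_kronecker, inv_one] at h1
  have h2 := Matrix.conjTranspose_mul_mul_mono (Matrix.kronecker_mono_left hZ.transpose h1)
    (gammaEmbedding a b)
  rw [gammaEmbedding_conj_kronecker_transpose] at h2
  refine le_of_eq_of_le ?_ h2
  have e : (Sᴴ * τ'⁻¹ * S) ⊗ₖ Zᵀ = (S ⊗ₖ (1 : Matrix (a × b) (a × b) ℂ))ᴴ * (τ'⁻¹ ⊗ₖ Zᵀ) *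
      (S ⊗ₖ (1 : Matrix (a × b) (a × b) ℂ)) := by
    rw [Matrix.conjTranspose_kronecker, ← Matrix.mul_kronecker_mul, ← Matrix.mul_kronecker_mul]
    simp
  rw [e, Matrix.conjTranspose_mul]
  simp only [Matrix.mul_assoc]

theorem conjTranspose_mul_self_eq_one_of_partialTraceRight {S : Matrix (a × b) (a × b) ℂ}
    (hS : partialTraceRight (Sᴴ * S) = 1) :
    ((S ⊗ₖ (1 : Matrix (a × b) (a × b) ℂ)) * gammaEmbedding a b)ᴴ *
      ((S ⊗ₖ (1 : Matrix (a × b) (a × b) ℂ)) * gammaEmbedding a b) = 1 := by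
  have h := gammaEmbedding_conj_kronecker_one (Sᴴ * S)
  rw [hS, Matrix.one_kronecker_one] at h
  rw [← h, Matrix.conjTranspose_mul, ← mul_one (1 : Matrix (a × b) (a × b) ℂ),
    Matrix.mul_kronecker_mul, Matrix.conjTranspose_kronecker]
  simp only [Matrix.mul_assoc, mul_one, Matrix.conjTranspose_one]

theorem trace_mul_kronecker_one_mul_conjTranspose {S : Matrix (a × b) (a × b) ℂ}
    (hS : partialTraceRight (Sᴴ * S) = 1) (τ : Matrix a a ℂ) :
    (S * (τ ⊗ₖ (1 : Matrix b b ℂ)) * Sᴴ).trace = τ.trace := by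
  have h := partialTraceRight_kronecker_mul_mul τ 1 (Sᴴ * S)
  rw [hS, Matrix.one_kronecker_one, mul_one, mul_one, mul_one] at h
  rw [Matrix.mul_assoc, Matrix.trace_mul_comm, Matrix.mul_assoc, ← trace_partialTraceRight, h]

/-- A feasible reference operator on the composite system that nearly compresses to `τ`. -/
theorem exists_posDef_trace_le_one {S : Matrix (a × b) (a × b) ℂ} {τ : Matrix a a ℂ}
    (hS : partialTraceRight (Sᴴ * S) = 1) (hτ : τ.PosDef) (htr : τ.trace ≤ 1) {θ : ℝ}
    (hθ : 0 < θ) : ∃ τ' : Matrix (a × b) (a × b) ℂ, τ'.PosDef ∧ τ'.trace ≤ 1 ∧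
      S * (((1 + θ)⁻¹ • τ) ⊗ₖ (1 : Matrix b b ℂ)) * Sᴴ ≤ τ' := by
  set d : ℝ := (Fintype.card (a × b) : ℝ) with hd
  have hd0 : 0 ≤ d := by positivity
  set δ := θ / (d + 1)
  have hδ : 0 < δ := by positivity
  have hδd : δ * d ≤ θ := by
    rw [div_mul_eq_mul_div, div_le_iff₀ (by positivity)]
    nlinarith
  have hS0 : (S * (τ ⊗ₖ (1 : Matrix b b ℂ)) * Sᴴ).PosSemidef :=
    (hτ.posSemidef.kronecker Matrix.PosSemidef.one).mul_mul_conjTranspose_same S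
  have hinv : (0 : ℝ) < (1 + θ)⁻¹ := by positivity
  -- The term `δ • 1` makes `τ'` invertible even if `S` is not; the prefactor compensates for its
  -- trace `δ d ≤ θ`.
  refine ⟨(1 + θ)⁻¹ • (S * (τ ⊗ₖ (1 : Matrix b b ℂ)) * Sᴴ + δ • 1), ?_, ?_, ?_⟩
  · exact ((Matrix.posDef_smul_one hδ).posSemidef_add hS0).smul hinv
  · rw [Matrix.trace_smul, Matrix.trace_add, trace_mul_kronecker_one_mul_conjTranspose hS,
      Matrix.trace_smul, Matrix.trace_one]
    rw [Complex.le_def] at htr ⊢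
    obtain ⟨h1, h2⟩ := htr
    constructor
    · have : (1 + θ)⁻¹ * (τ.trace.re + δ * d) ≤ (1 + θ)⁻¹ * (1 + θ) := by
        have : τ.trace.re ≤ 1 := by simpa using h1
        gcongr
      rw [inv_mul_cancel₀ (by positivity)] at this
      simpa only [Complex.smul_re, Complex.add_re, smul_eq_mul, Complex.natCast_re,
        Complex.one_re] using this
    · have : τ.trace.im = 0 := by simpa using h2
      simp [this]
  · rw [Matrix.smul_kronecker, Matrix.mul_smul, Matrix.smul_mul]
    refine Matrix.smul_mono ?_ hinv.le
    exact le_add_of_nonneg_right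
      (Matrix.nonneg_iff_posSemidef.2 (Matrix.posDef_smul_one hδ).posSemidef)

theorem exists_qTau_sub_le [Nonempty b] {f : ℝ → ℝ} (hf : OperatorAntiMonotone f)
    {X Y : Matrix (a × b) (a × b) ℂ} (hX : X.PosSemidef) (hY : Y.PosSemidef) {τ : Matrix a a ℂ}
    (hτ : τ.PosDef) (htr : τ.trace ≤ 1) {ε : ℝ} (hε : 0 < ε) {e : ℝ} (he : 0 < e) :
    ∃ τ' : Matrix (a × b) (a × b) ℂ, τ'.PosDef ∧ τ'.trace ≤ 1 ∧ ∃ ε' : ℝ, 0 < ε' ∧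
      qTau f (partialTraceRight X)
        (partialTraceRight Y + ε • kernelProj (partialTraceRight Y)) τ - e ≤
      qTau f X (Y + ε' • kernelProj Y) τ' := by
  set ρ := partialTraceRight X
  set Z := partialTraceRight Y + ε • kernelProj (partialTraceRight Y)
  have hZ : Z.PosDef := hY.partialTraceRight.posDef_add_smul_kernelProj hε
  have hT : (τ⁻¹ ⊗ₖ Zᵀ).PosDef := hτ.inv.kronecker hZ.transpose
  have hnorm : 0 ≤ (star (phiVec ρ) ⬝ᵥ phiVec ρ).re :=
    (Complex.le_def.1 (dotProduct_star_self_nonneg (phiVec ρ))).1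
  set N := (star (phiVec ρ) ⬝ᵥ phiVec ρ).re
  -- The error is divided by `N + 1` since pairing with `φ^ρ` multiplies it by `N`, which may be
  -- zero.
  obtain ⟨η, hη, hcfc⟩ := hf.exists_cfc_sub_le hT (e := e / (N + 1)) (by positivity)
  -- Three factors `1 + θ` accumulate, from rescaling `τ`, regularizing `Y` and Jensen; `(1 + θ)³ ≤
  -- 1 + 7θ` for `θ ≤ 1`.
  set θ := min 1 (η / 7)
  have hθ : 0 < θ := by positivity
  have hθ1 : θ ≤ 1 := min_le_left _ _
  have hθη : (1 + θ) * ((1 + θ) * (1 + θ)) ≤ 1 + η := by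
    have : θ ≤ η / 7 := min_le_right _ _
    nlinarith [mul_pos hθ hθ]
  obtain ⟨S, hS1, hS2⟩ := hX.exists_partialTraceRight_eq_one
  obtain ⟨τ', hτ', htr', hSτ⟩ := exists_posDef_trace_le_one hS1 hτ htr hθ
  obtain ⟨ε', hε', hYε⟩ := exists_partialTraceRight_add_smul_le (posSemidef_kernelProj Y) hZ
    (le_add_of_nonneg_right (Matrix.nonneg_iff_posSemidef.2
      ((posSemidef_kernelProj (partialTraceRight Y)).smul hε.le))) hθ
  refine ⟨τ', hτ', htr', ε', hε', ?_⟩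
  have hZ' := hY.posDef_add_smul_kernelProj hε'
  set Z' := Y + ε' • kernelProj Y
  have hWW := conjTranspose_mul_self_eq_one_of_partialTraceRight hS1
  have hWφ := gammaEmbedding_mulVec_phiVec hS2
  have hWM := conj_kronecker_transpose_le (hτ.smul (inv_pos.2 (by positivity : 0 < 1 + θ))) hτ'
    hZ'.posSemidef hSτ
  set W := (S ⊗ₖ (1 : Matrix (a × b) (a × b) ℂ)) * gammaEmbedding a b
  have hτinv : ((1 + θ)⁻¹ • τ)⁻¹ = (1 + θ) • τ⁻¹ := by
    refine Matrix.inv_eq_left_inv ?_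
    rw [Matrix.smul_mul, Matrix.mul_smul, smul_smul, mul_inv_cancel₀ (by positivity), one_smul,
      Matrix.nonsing_inv_mul _ ((Matrix.isUnit_iff_isUnit_det _).1 hτ.isUnit)]
  have hWN : Wᴴ * (τ'⁻¹ ⊗ₖ Z'ᵀ) * W ≤ ((1 + θ) * (1 + θ)) • (τ⁻¹ ⊗ₖ Zᵀ) := by
    refine hWM.trans ?_
    rw [hτinv, Matrix.smul_kronecker, mul_smul]
    refine Matrix.smul_mono ?_ (by positivity)
    rw [← Matrix.kronecker_smul, ← Matrix.transpose_smul]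
    exact Matrix.kronecker_mono_right hτ.inv.posSemidef (Matrix.transpose_mono hYε)
  have hJ := hf.cfc_le_conjTranspose_mul_cfc_mul hWW (hτ'.inv.kronecker hZ'.transpose) hWN hθ
  rw [smul_smul] at hJ
  have hmono : cfc f ((1 + η) • (τ⁻¹ ⊗ₖ Zᵀ)) ≤
      cfc f (((1 + θ) * ((1 + θ) * (1 + θ))) • (τ⁻¹ ⊗ₖ Zᵀ)) := by
    refine hf.cfc_le_cfc (hT.smul (by positivity)) ?_
    rw [Matrix.le_iff, ← sub_smul]
    exact hT.posSemidef.smul (sub_nonneg.2 hθη)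
  have hfin := Matrix.re_dotProduct_mulVec_mono (hcfc.trans (hmono.trans hJ)) (phiVec ρ)
  have hR : star (phiVec ρ) ⬝ᵥ ((Wᴴ * cfc f (τ'⁻¹ ⊗ₖ Z'ᵀ) * W) *ᵥ phiVec ρ) =
      star (phiVec X) ⬝ᵥ (cfc f (τ'⁻¹ ⊗ₖ Z'ᵀ) *ᵥ phiVec X) := by
    rw [← hWφ, Matrix.star_mulVec, ← Matrix.dotProduct_mulVec, Matrix.mulVec_mulVec,
      Matrix.mulVec_mulVec, Matrix.mul_assoc]
  rw [hR, Matrix.sub_mulVec, Matrix.smul_mulVec, Matrix.one_mulVec, dotProduct_sub,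
    dotProduct_smul, Complex.sub_re, Complex.smul_re] at hfin
  have hNe : e / (N + 1) * N ≤ e := by
    rw [div_mul_eq_mul_div, div_le_iff₀ (by positivity)]
    nlinarith
  rw [smul_eq_mul] at hfin
  unfold qTau
  linarith

theorem qTau_le_optimizedFDiv {f : ℝ → ℝ} (X Y : Matrix a a ℂ) {τ : Matrix a a ℂ}
    (hτ : τ.PosDef) (htr : τ.trace ≤ 1) {ε : ℝ} (hε : 0 < ε) :
    (qTau f X (Y + ε • kernelProj Y) τ : EReal) ≤ optimizedFDiv f X Y := by
  rw [← Complex.coe_smul]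
  exact le_iSup_of_le τ <| le_iSup_of_le hτ <| le_iSup_of_le htr <| le_iSup_of_le ε <|
    le_iSup_of_le hε le_rfl

end Monotonicity

theorem mainTheorem2 {a b : Type*} [Fintype a] [DecidableEq a] [Fintype b] [DecidableEq b]
    (f : ℝ → ℝ) (hf : OperatorAntiMonotone f)
    (X Y : Matrix (a × b) (a × b) ℂ) (hX : X.PosSemidef) (hY : Y.PosSemidef) :
    optimizedFDiv f (partialTraceRight X) (partialTraceRight Y) ≤ optimizedFDiv f X Y := by
  refine iSup_le fun τ => iSup_le fun hτ => iSup_le fun htr => iSup_le fun ε => iSup_le fun hε => ?_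
  rw [Complex.coe_smul]
  -- For empty `b` the operator `S` need not exist, but both vectors `φ` vanish and `τ' = 1` is
  -- feasible with trace `0`.
  rcases isEmpty_or_nonempty b with hb | hb
  · have hX0 : partialTraceRight X = 0 := by ext i j; simp [partialTraceRight]
    have hφ : phiVec (0 : Matrix a a ℂ) = 0 := by
      ext p; rw [phiVec_apply, CFC.sqrt_zero]; rfl
    have h0 := qTau_le_optimizedFDiv (f := f) X Y (τ := 1) Matrix.PosDef.one
      (by simp [Matrix.trace]) one_pos
    refine le_trans (le_of_eq ?_) h0
    rw [hX0]
    simp [qTau, hφ, dotProduct]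
  · refine le_of_forall_lt_imp_le_of_dense fun c hc => ?_
    obtain ⟨r, hcr, hrq⟩ := EReal.lt_iff_exists_real_btwn.1 hc
    obtain ⟨τ', hτ', htr', ε', hε', h⟩ := exists_qTau_sub_le hf hX hY hτ htr hε
      (sub_pos.2 (EReal.coe_lt_coe_iff.1 hrq))
    rw [sub_sub_cancel] at h
    exact hcr.le.trans ((EReal.coe_le_coe_iff.2 h).trans (qTau_le_optimizedFDiv X Y hτ' htr' hε'))
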